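/- **Setting.** A pseudometric on a set $M$ is a function $m:M\times M\to[0,1]$ with $m(x,x)=0$, $m(x,y)=m(y,x)$ and $m(x,z)\le m(x,y)+m(y,z)$. It induces the uniformity $\mathcal U_m=\{E\subseteq M\times M : \exists\,\epsilon>0,\ \{(x,y): m(x,y)<\epsilon\}\subseteq E\}$. A uniformity (not required to be separated) of this form is called pseudo-metrizable, and $\mathcal{PMU}(M)$ is the set of these, ordered by $\mathcal U_1\le\mathcal U_2$ iff $\mathcal U_2\subseteq\mathcal U_1$. *GSMP.* A finite-state generalized semi-Markov process consists of a finite set $S$ of states; for each $s\in S$ a finite nonempty set $I(s)$ of events (clocks), a rate $r_{s,i}>0$ for each $i\in I(s)$, and a set of atomic propositions; for $i\in I(s)$ a transition probability $\mathrm{next}_i(s,\cdot)$ on $S$; and for $i\in I(s)$, $i'\in I(s')$ a continuous probability density $f(\cdot\,;s,i;s',i')$ on $[0,\infty)$. A generalized state is a pair $\langle s,c\rangle$ with $c\in(0,\infty)^{I(s)}$ for which a unique $i\in I(s)$ minimizes $c_i/r_{s,i}$; this minimum is the sojourn time $T\langle s,c\rangle$. Let $\mathcal G$ be the set of generalized states.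 From $\langle s,c\rangle\in\mathcal G$ with first clock $i$, the target $s'$ is drawn from $\mathrm{next}_i(s,\cdot)$; a clock $j\in I(s')\cap(I(s)\setminus\{i\})$ gets the value $c_j-r_{s,j}T\langle s,c\rangle$, and the other clocks $i'$ of $s'$ get independent new values with densities $f(\cdot\,;s,i;s',i')$. This defines a discrete-time Markov process; it is stopped if it reaches a pair outside $\mathcal G$. *Traces.* A sequence $(g_n)$ in $\mathcal G$ is finitely varying if $\sum_n T(g_n)=\infty$. It generates $f:[0,\infty)\to\mathcal G$: if $\sum_{j<n}T(g_j)\le t<\sum_{j\le n}T(g_j)$ and $g_n=\langle s,c\rangle$, then $f(t)=\langle s,\,c-r_s\,(t-\sum_{j<n}T(g_j))\rangle$. For $g\in\mathcal G$, $\mathrm{Traces}(g)$ is the law of the process started at $g$, restricted to the set of finitely varying sequences in $\mathcal G$. *Lifts.* For a pseudometric $m$ on $M$ and $f,f':[0,\infty)\to M$ let $$J(m)(f,f')=\max\Bigl(\sup_t\inf_{t'}\max(m(f(t),f'(t')),|t-t'|),\ \sup_{t'}\inf_{t}\max(m(f(t),f'(t')),|t-t'|)\Bigr)$$ (Skorohod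 $J_2$); on finitely varying sequences, $J(m)$ is applied to the functions they generate. For a pseudometric $d$ on a measurable space $\Omega$ and measures $P,Q$ of mass at most $1$ let $$W(d)(P,Q)=\sup_h\Bigl|\int h\,dP-\int h\,dQ\Bigr|,$$ the supremum over all $h:\Omega\to[0,1]$ with $|h(x)-h(y)|\le d(x,y)$ (Wasserstein); for a non-measurable $h$ the integrals are lower integrals. *Functional.* For $0<k\le1$ and a pseudometric $m$ on $\mathcal G$ let $\mathcal F_k(m)(g,g')=k\cdot W(J(m))(\mathrm{Traces}(g),\mathrm{Traces}(g'))$, which is again a pseudometric on $\mathcal G$. On uniformities, $\mathcal F_k(\mathcal U_m)=\mathcal U_{\mathcal F_k(m)}$. **Lemma.** For every finite-state GSMP and every $0<k\le1$ the functional $\mathcal F_k:\mathcal{PMU}(\mathcal G)\to\mathcal{PMU}(\mathcal G)$ is well defined: the uniformity $\mathcal U_{\mathcal F_k(m)}$ depends on $m$ only through $\mathcal U_m$. Moreover $\mathcal F_k=\mathcal F_{k'}$ for all $0<k,k'\le 1$. -/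

import Mathlib

open MeasureTheory ProbabilityTheory Filter Topology Set
open scoped NNReal ENNReal

/-! ### Pseudometrics with values in `[0,1]` and the uniformities they induce -/

/-- A pseudometric with values in `[0,1]`. -/
structure UnitPseudoMetric (M : Type*) where
  dist : M → M → ℝ
  nonneg : ∀ x y, 0 ≤ dist x y
  le_one : ∀ x y, dist x y ≤ 1
  self : ∀ x, dist x x = 0
  symm : ∀ x y, dist x y = dist y x
  triangle : ∀ x y z, dist x z ≤ dist x y + dist y z

namespace UnitPseudoMetric

/-- The uniformity whose entourages are the supersets of the sets `{(x, y) | m x y < ε}`, `ε > 0`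
(see `mem_uniformity_iff`). Mathlib's `UniformSpace` does not require separation. -/
@[reducible] def uniformSpace {M : Type*} (m : UnitPseudoMetric M) : UniformSpace M :=
  UniformSpace.ofDist m.dist m.self m.symm m.triangle

theorem mem_uniformity_iff {M : Type*} (m : UnitPseudoMetric M) (E : Set (M × M)) :
    E ∈ @uniformity M m.uniformSpace ↔ ∃ ε > 0, {p : M × M | m.dist p.1 p.2 < ε} ⊆ E := by
  have h := UniformSpace.hasBasis_ofFun (M := ℝ) ⟨1, one_pos⟩ m.dist m.self m.symm m.triangle
    fun ε hε => ⟨ε / 2, half_pos hε, fun x hx y hy => by linarith⟩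
  exact h.mem_iff

/-- The pseudometric `(x, y) ↦ m (φ x) (φ y)`. -/
def pullback {M N : Type*} (m : UnitPseudoMetric N) (φ : M → N) : UnitPseudoMetric M where
  dist x y := m.dist (φ x) (φ y)
  nonneg _ _ := m.nonneg _ _
  le_one _ _ := m.le_one _ _
  self _ := m.self _
  symm _ _ := m.symm _ _
  triangle _ _ _ := m.triangle _ _ _

/-- The rescaled pseudometric `k * m`, for `0 < k ≤ 1`. -/
def scale {M : Type*} (k : Set.Ioc (0 : ℝ) 1) (m : UnitPseudoMetric M) : UnitPseudoMetric M where
  dist x y := (k : ℝ) * m.dist x y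
  nonneg x y := mul_nonneg k.2.1.le (m.nonneg x y)
  le_one x y := mul_le_one₀ k.2.2 (m.nonneg x y) (m.le_one x y)
  self x := by simp [m.self]
  symm x y := by rw [m.symm]
  triangle x y z := by
    rw [← mul_add]
    exact mul_le_mul_of_nonneg_left (m.triangle x y z) k.2.1.le

end UnitPseudoMetric

/-- The pseudo-metrizable uniformities on `M`. As a subtype of `UniformSpace M` it carries the order
in which `U₁ ≤ U₂` iff every entourage of `U₂` is an entourage of `U₁`. -/
abbrev PMU (M : Type*) : Type _ := {U : UniformSpace M // ∃ m : UnitPseudoMetric M, m.uniformSpace = U}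

/-- The pseudo-metrizable uniformity induced by a pseudometric. -/
def UnitPseudoMetric.toPMU {M : Type*} (m : UnitPseudoMetric M) : PMU M := ⟨m.uniformSpace, m, rfl⟩

/-! ### The Skorohod `J₂` metric -/

/-- The `J₂` distance between `f` and `g`: the Hausdorff distance of their graphs in
`[0,∞) × M` with the maximum metric. -/
noncomputable def j2Dist {M : Type*} (m : UnitPseudoMetric M) (f g : ℝ≥0 → M) : ℝ :=
  max (⨆ t : ℝ≥0, ⨅ t' : ℝ≥0, max (m.dist (f t) (g t')) |(t : ℝ) - t'|)
    (⨆ t' : ℝ≥0, ⨅ t : ℝ≥0, max (m.dist (f t) (g t')) |(t : ℝ) - t'|)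

section J2

variable {M : Type*} (m : UnitPseudoMetric M)

theorem j2_bddBelow (f g : ℝ≥0 → M) (t : ℝ≥0) :
    BddBelow (range fun t' : ℝ≥0 => max (m.dist (f t) (g t')) |(t : ℝ) - t'|) :=
  ⟨0, by rintro _ ⟨t', rfl⟩; exact le_max_of_le_left (m.nonneg _ _)⟩

theorem j2_iInf_nonneg (f g : ℝ≥0 → M) (t : ℝ≥0) :
    0 ≤ ⨅ t' : ℝ≥0, max (m.dist (f t) (g t')) |(t : ℝ) - t'| :=
  le_ciInf fun _ => le_max_of_le_left (m.nonneg _ _)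

theorem j2_iInf_le_one (f g : ℝ≥0 → M) (t : ℝ≥0) :
    ⨅ t' : ℝ≥0, max (m.dist (f t) (g t')) |(t : ℝ) - t'| ≤ 1 :=
  (ciInf_le (j2_bddBelow m f g t) t).trans (by simp [m.le_one])

/-- The one-sided Hausdorff excess of the graph of `f` over the graph of `g`. -/
noncomputable def j2Half (f g : ℝ≥0 → M) : ℝ :=
  ⨆ t : ℝ≥0, ⨅ t' : ℝ≥0, max (m.dist (f t) (g t')) |(t : ℝ) - t'|

theorem j2Dist_eq (f g : ℝ≥0 → M) : j2Dist m f g = max (j2Half m f g) (j2Half m g f) := by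
  unfold j2Dist j2Half
  congr 1
  refine iSup_congr fun t' => iInf_congr fun t => ?_
  rw [m.symm, abs_sub_comm]

theorem j2_iInf_le_half (f g : ℝ≥0 → M) (t : ℝ≥0) :
    ⨅ t' : ℝ≥0, max (m.dist (f t) (g t')) |(t : ℝ) - t'| ≤ j2Half m f g :=
  le_ciSup (f := fun t : ℝ≥0 => ⨅ t' : ℝ≥0, max (m.dist (f t) (g t')) |(t : ℝ) - t'|)
    ⟨1, by rintro _ ⟨t, rfl⟩; exact j2_iInf_le_one m f g t⟩ t

theorem j2Half_triangle (f g h : ℝ≥0 → M) :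
    j2Half m f h ≤ j2Half m f g + j2Half m g h := by
  refine ciSup_le fun t => le_of_forall_pos_le_add fun ε hε => ?_
  obtain ⟨u, hu⟩ := exists_lt_of_ciInf_lt
    (lt_of_le_of_lt (j2_iInf_le_half m f g t) (lt_add_of_pos_right _ (half_pos hε)))
  obtain ⟨v, hv⟩ := exists_lt_of_ciInf_lt
    (lt_of_le_of_lt (j2_iInf_le_half m g h u) (lt_add_of_pos_right _ (half_pos hε)))
  refine (ciInf_le (j2_bddBelow m f h t) v).trans ?_
  have h1 := m.triangle (f t) (g u) (h v)
  have h2 := abs_sub_le (t : ℝ) u v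
  rw [max_lt_iff] at hu hv
  exact max_le (by linarith [hu.1, hv.1]) (by linarith [hu.2, hv.2])

/-- The `J₂` pseudometric on functions `[0,∞) → M` (in particular on the cadlag ones). -/
noncomputable def UnitPseudoMetric.J : UnitPseudoMetric (ℝ≥0 → M) where
  dist := j2Dist m
  nonneg f g := by
    rw [j2Dist_eq]
    exact le_max_of_le_left ((j2_iInf_nonneg m f g 0).trans (j2_iInf_le_half m f g 0))
  le_one f g := by
    rw [j2Dist_eq]
    exact max_le (ciSup_le (j2_iInf_le_one m f g)) (ciSup_le (j2_iInf_le_one m g f))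
  self f := by
    rw [j2Dist_eq, max_self]
    refine le_antisymm (ciSup_le fun t => ?_) ((j2_iInf_nonneg m f f 0).trans (j2_iInf_le_half m f f 0))
    exact (ciInf_le (j2_bddBelow m f f t) t).trans (by simp [m.self])
  symm f g := by rw [j2Dist_eq, j2Dist_eq, max_comm]
  triangle f g h := by
    simp only [j2Dist_eq]
    have h1 := j2Half_triangle m f g h
    have h2 := j2Half_triangle m h g f
    refine max_le (h1.trans (add_le_add (le_max_left _ _) (le_max_left _ _))) (h2.trans ?_)
    rw [add_comm]
    exact add_le_add (le_max_right _ _) (le_max_right _ _)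

end J2

/-! ### The Wasserstein metric -/

/-- The lower integral of a function `h ≥ 0`. It is the integral `∫ h dμ` when `h` is measurable
(see `lowerIntegral_eq_integral`), and it also makes sense when `h` is not. -/
noncomputable def lowerIntegral {Ω : Type*} [MeasurableSpace Ω] (μ : Measure Ω) (h : Ω → ℝ) : ℝ :=
  (∫⁻ x, ENNReal.ofReal (h x) ∂μ).toReal

theorem lowerIntegral_eq_integral {Ω : Type*} [MeasurableSpace Ω] (μ : Measure Ω) (h : Ω → ℝ)
    (h_meas : Measurable h) (h_nonneg : ∀ x, 0 ≤ h x) : lowerIntegral μ h = ∫ x, h x ∂μ :=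
  (integral_eq_lintegral_of_nonneg_ae (ae_of_all _ h_nonneg) h_meas.aestronglyMeasurable).symm

/-- Distributions: measures of total mass at most one (in particular all probability measures). -/
abbrev Distr (Ω : Type*) [MeasurableSpace Ω] : Type _ := {μ : Measure Ω // μ univ ≤ 1}

/-- The functions `h : Ω → [0,1]` with `|h s - h s'| ≤ m s s'`. -/
abbrev UnitPseudoMetric.Lip {Ω : Type*} (m : UnitPseudoMetric Ω) : Type _ :=
  {h : Ω → ℝ // (∀ s, 0 ≤ h s ∧ h s ≤ 1) ∧ ∀ s s', |h s - h s'| ≤ m.dist s s'}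

section Wasserstein

variable {Ω : Type*} [MeasurableSpace Ω] (m : UnitPseudoMetric Ω)

/-- The Wasserstein distance: the supremum over all `h : Ω → [0,1]` with `|h s - h s'| ≤ m s s'`
of `|∫ h dP - ∫ h dQ|`. -/
noncomputable def wDist (P Q : Distr Ω) : ℝ :=
  ⨆ h : m.Lip, |lowerIntegral P.1 h.1 - lowerIntegral Q.1 h.1|

theorem lowerIntegral_nonneg (P : Distr Ω) (h : Ω → ℝ) : 0 ≤ lowerIntegral P.1 h :=
  ENNReal.toReal_nonneg

theorem lowerIntegral_le_one (P : Distr Ω) (h : m.Lip) : lowerIntegral P.1 h.1 ≤ 1 := by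
  have h1 : (∫⁻ x, ENNReal.ofReal (h.1 x) ∂P.1) ≤ 1 := by
    calc (∫⁻ x, ENNReal.ofReal (h.1 x) ∂P.1) ≤ ∫⁻ _, 1 ∂P.1 :=
          lintegral_mono fun x => ENNReal.ofReal_le_one.2 (h.2.1 x).2
      _ ≤ 1 := by simpa using P.2
  exact ENNReal.toReal_mono ENNReal.one_ne_top h1

theorem wDist_term_le_one (P Q : Distr Ω) (h : m.Lip) :
    |lowerIntegral P.1 h.1 - lowerIntegral Q.1 h.1| ≤ 1 := by
  have h1 := lowerIntegral_nonneg P h.1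
  have h2 := lowerIntegral_nonneg Q h.1
  have h3 := lowerIntegral_le_one m P h
  have h4 := lowerIntegral_le_one m Q h
  exact abs_le.2 ⟨by linarith, by linarith⟩

theorem le_wDist (P Q : Distr Ω) (h : m.Lip) :
    |lowerIntegral P.1 h.1 - lowerIntegral Q.1 h.1| ≤ wDist m P Q :=
  le_ciSup (f := fun h : m.Lip => |lowerIntegral P.1 h.1 - lowerIntegral Q.1 h.1|)
    ⟨1, by rintro _ ⟨h, rfl⟩; exact wDist_term_le_one m P Q h⟩ h

instance UnitPseudoMetric.Lip.instNonempty {Ω : Type*} (m : UnitPseudoMetric Ω) : Nonempty m.Lip :=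
  ⟨⟨fun _ => 0, by simp [m.nonneg]⟩⟩

/-- The Wasserstein pseudometric. -/
noncomputable def UnitPseudoMetric.W : UnitPseudoMetric (Distr Ω) where
  dist := wDist m
  nonneg P Q := Real.iSup_nonneg fun _ => abs_nonneg _
  le_one P Q := ciSup_le (wDist_term_le_one m P Q)
  self P := by simp [wDist]
  symm P Q := iSup_congr fun h => abs_sub_comm _ _
  triangle P Q R := ciSup_le fun h => (abs_sub_le _ (lowerIntegral Q.1 h.1) _).trans
    (add_le_add (le_wDist m P Q h) (le_wDist m Q R h))

end Wasserstein

/-! ### Generalized semi-Markov processes -/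

/-- A finite-state generalized semi-Markov process with states `S`, events (clocks) drawn from `E`
and atomic propositions `AP`. -/
structure GSMP (AP S E : Type*) [Fintype S] where
  /-- the finite set `I(s)` of events of the state `s` -/
  events : S → Finset E
  events_nonempty : ∀ s, (events s).Nonempty
  /-- the rate at which a clock of `s` runs down -/
  rate : ∀ s, events s → ℝ
  rate_pos : ∀ s i, 0 < rate s i
  /-- the labelling by atomic propositions -/
  props : S → Set AP
  /-- `density s i s' i'` is the probability density on `[0,∞)` used to set the clock `i'` of `s'`
  when `i` fires in `s` and the target is `s'` -/
  density : ∀ s, events s → ∀ s', events s' → ℝ → ℝ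
  density_nonneg : ∀ s i s' i' t, 0 ≤ t → 0 ≤ density s i s' i' t
  density_continuousOn : ∀ s i s' i', ContinuousOn (density s i s' i') (Ici 0)
  density_lintegral : ∀ s i s' i', ∫⁻ t in Ici 0, ENNReal.ofReal (density s i s' i' t) = 1
  /-- `next s i s'` is the probability that the target is `s'` when `i` fires in `s` -/
  next : ∀ s, events s → S → ℝ
  next_nonneg : ∀ s i s', 0 ≤ next s i s'
  next_sum : ∀ s i, ∑ s', next s i s' = 1

namespace GSMP

variable {AP S E : Type*} [Fintype S] (A : GSMP AP S E)

/-- A state together with a vector of clock values, one for each of its events. -/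
abbrev Config : Type _ := Σ s : S, (A.events s → ℝ)

/-- The time after which the clock `i` reaches `0`. -/
noncomputable def hitTime (x : A.Config) (i : A.events x.1) : ℝ := x.2 i / A.rate x.1 i

/-- `i` is the unique clock that reaches `0` first. -/
def IsFirst (x : A.Config) (i : A.events x.1) : Prop :=
  ∀ j, j ≠ i → A.hitTime x i < A.hitTime x j

/-- Clock values are positive, and a unique clock reaches `0` first. -/
def IsGen (x : A.Config) : Prop := (∀ i, 0 < x.2 i) ∧ ∃ i, A.IsFirst x i

/-- The generalized states. -/
abbrev GenState : Type _ := {x : A.Config // A.IsGen x}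

/-- The time until the first clock reaches `0`. -/
noncomputable def sojourn (x : A.Config) : ℝ := ⨅ i, A.hitTime x i

/-- The clock of a generalized state that reaches `0` first. -/
noncomputable def firstClock (x : A.GenState) : A.events x.1.1 := x.2.2.choose

theorem firstClock_spec (x : A.GenState) : A.IsFirst x.1 (A.firstClock x) := x.2.2.choose_spec

theorem IsFirst.unique {x : A.Config} {i j : A.events x.1} (hi : A.IsFirst x i)
    (hj : A.IsFirst x j) : i = j := by
  by_contra h
  exact lt_asymm (hi j (Ne.symm h)) (hj i h)

theorem IsFirst.sojourn_eq {x : A.Config} {i : A.events x.1} (hi : A.IsFirst x i) :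
    A.sojourn x = A.hitTime x i := by
  have : Nonempty (A.events x.1) := ⟨i⟩
  refine le_antisymm (ciInf_le (Finite.bddBelow_range _) i) (le_ciInf fun j => ?_)
  by_cases h : j = i
  · rw [h]
  · exact (hi j h).le

/-- Letting the clocks run down for time `τ` at their rates. -/
noncomputable def evolve (x : A.Config) (τ : ℝ) : A.Config :=
  ⟨x.1, fun i => x.2 i - A.rate x.1 i * τ⟩

theorem hitTime_evolve (x : A.Config) (τ : ℝ) (i : A.events x.1) :
    A.hitTime (A.evolve x τ) i = A.hitTime x i - τ := by
  have h := (A.rate_pos x.1 i).ne'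
  simp only [hitTime, evolve]
  field_simp

theorem isGen_evolve {x : A.Config} (hx : A.IsGen x) {τ : ℝ} (hτ : τ < A.sojourn x) :
    A.IsGen (A.evolve x τ) := by
  obtain ⟨i, hi⟩ := hx.2
  refine ⟨fun j => ?_, i, fun j hj => ?_⟩
  · have h1 : τ < x.2 j / A.rate x.1 j := hτ.trans_le (ciInf_le (Finite.bddBelow_range _) j)
    have h2 := (lt_div_iff₀ (A.rate_pos x.1 j)).1 h1
    change 0 < x.2 j - A.rate x.1 j * τ
    linarith
  · have h1 := A.hitTime_evolve x τ i
    have h2 := A.hitTime_evolve x τ j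
    have h3 := hi j hj
    exact h1.trans_lt (lt_of_lt_of_eq (by linarith) h2.symm)

/-! #### The Markov kernel -/

/-- The law of freshly set clocks of `s'` after `i` fired in `s`: independent, with the given
densities. -/
noncomputable def freshLaw (s : S) (i : A.events s) (s' : S) : Measure (A.events s' → ℝ) :=
  Measure.pi fun i' =>
    (volume.restrict (Ici 0)).withDensity fun t => ENNReal.ofReal (A.density s i s' i' t)

instance (s : S) (i : A.events s) (s' : S) : IsProbabilityMeasure (A.freshLaw s i s') := by
  have h : ∀ i', IsProbabilityMeasure ((volume.restrict (Ici (0 : ℝ))).withDensity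
      fun t => ENNReal.ofReal (A.density s i s' i' t)) := fun i' =>
    ⟨by rw [withDensity_apply _ MeasurableSet.univ, Measure.restrict_univ, A.density_lintegral]⟩
  unfold freshLaw
  infer_instance

open Classical in
/-- The clocks of the target `s'` when `i` fires in `s` with clock values `c`: a clock in
`I(s') ∩ (I(s) \ {i})` keeps its value after the evolution up to the firing of `i`, the other
clocks of `s'` get the new values `z`. -/
noncomputable def newClocks (s : S) (i : A.events s) (s' : S) (c : A.events s → ℝ)
    (z : A.events s' → ℝ) : A.events s' → ℝ := fun i' =>
  if h : (i' : E) ∈ A.events s ∧ (i' : E) ≠ i then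
    c ⟨i', h.1⟩ - A.rate s ⟨i', h.1⟩ * (c i / A.rate s i)
  else z i'

/-- The law of the next configuration when `i` fires in `s` with clock values `c`. -/
noncomputable def stepLaw (s : S) (i : A.events s) (c : A.events s → ℝ) : Measure A.Config :=
  ∑ s', ENNReal.ofReal (A.next s i s') •
    (A.freshLaw s i s').map fun z => (⟨s', A.newClocks s i s' c z⟩ : A.Config)

open Classical in
/-- The law of the next configuration. A configuration that is not a generalized state is made
absorbing; only sequences that never meet one are used below. -/
noncomputable def kernelFun (x : A.Config) : Measure A.Config :=
  if h : A.IsGen x then A.stepLaw x.1 (A.firstClock ⟨x, h⟩) x.2 else Measure.dirac x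

theorem measurable_mk (s : S) : Measurable (fun c : A.events s → ℝ => (⟨s, c⟩ : A.Config)) :=
  fun _ ht => MeasurableSpace.measurableSet_iInf.1 ht s

theorem measurable_of_fibers {β : Type*} [MeasurableSpace β] {f : A.Config → β}
    (hf : ∀ s, Measurable fun c : A.events s → ℝ => f ⟨s, c⟩) : Measurable f :=
  fun _ ht => MeasurableSpace.measurableSet_iInf.2 fun s => hf s ht

theorem measurableSet_of_fibers {B : Set A.Config}
    (hB : ∀ s, MeasurableSet {c : A.events s → ℝ | (⟨s, c⟩ : A.Config) ∈ B}) : MeasurableSet B :=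
  MeasurableSpace.measurableSet_iInf.2 hB

theorem measurableSet_isFirst (s : S) (i : A.events s) :
    MeasurableSet {c : A.events s → ℝ | A.IsFirst ⟨s, c⟩ i} := by
  simp only [IsFirst, hitTime, ofPred_forall]
  refine MeasurableSet.iInter fun j => MeasurableSet.iInter fun _ => ?_
  exact measurableSet_lt (by fun_prop) (by fun_prop)

theorem measurableSet_isGen : MeasurableSet {x : A.Config | A.IsGen x} := by
  refine A.measurableSet_of_fibers fun s => ?_
  have h : {c : A.events s → ℝ | (⟨s, c⟩ : A.Config) ∈ {x : A.Config | A.IsGen x}} =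
      (⋂ i, {c | 0 < c i}) ∩ ⋃ i : A.events s, {c : A.events s → ℝ | A.IsFirst ⟨s, c⟩ i} := by
    ext c
    simp [IsGen]
  rw [h]
  exact (MeasurableSet.iInter fun i => measurableSet_lt measurable_const (measurable_pi_apply i)).inter
    (MeasurableSet.iUnion fun i => A.measurableSet_isFirst s i)

theorem measurable_sojourn : Measurable A.sojourn := by
  refine A.measurable_of_fibers fun s => ?_
  simp only [sojourn, hitTime]
  exact Measurable.iInf fun i => by fun_prop

theorem measurable_newClocks (s : S) (i : A.events s) (s' : S) :
    Measurable fun p : (A.events s → ℝ) × (A.events s' → ℝ) => A.newClocks s i s' p.1 p.2 := by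
  refine measurable_pi_lambda _ fun i' => ?_
  by_cases h : (i' : E) ∈ A.events s ∧ (i' : E) ≠ i
  · simp only [newClocks, dif_pos h]
    fun_prop
  · simp only [newClocks, dif_neg h]
    fun_prop

theorem measurable_stepLaw (s : S) (i : A.events s) : Measurable (A.stepLaw s i) := by
  refine Measure.measurable_of_measurable_coe _ fun B hB => ?_
  simp only [stepLaw, Measure.coe_finsetSum, Finset.sum_apply, Measure.smul_apply, smul_eq_mul]
  refine Finset.measurable_sum _ fun s' _ => Measurable.const_mul ?_ _
  have h1 := (A.measurable_mk s').comp (A.measurable_newClocks s i s')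
  have h2 : ∀ c, (A.freshLaw s i s').map (fun z => (⟨s', A.newClocks s i s' c z⟩ : A.Config)) B =
      A.freshLaw s i s' (Prod.mk c ⁻¹' ((fun p : (A.events s → ℝ) × (A.events s' → ℝ) =>
        (⟨s', A.newClocks s i s' p.1 p.2⟩ : A.Config)) ⁻¹' B)) := fun c => by
    exact Measure.map_apply (h1.comp measurable_prodMk_left) hB
  simp only [h2]
  exact measurable_measure_prodMk_left (h1 hB)

instance (s : S) (i : A.events s) (c : A.events s → ℝ) : IsProbabilityMeasure (A.stepLaw s i c) := by
  refine ⟨?_⟩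
  simp only [stepLaw, Measure.coe_finsetSum, Finset.sum_apply, Measure.smul_apply, smul_eq_mul]
  have h : ∀ s', (A.freshLaw s i s').map (fun z => (⟨s', A.newClocks s i s' c z⟩ : A.Config)) univ
      = 1 := fun s' => by
    rw [Measure.map_apply _ MeasurableSet.univ, preimage_univ, measure_univ]
    exact ((A.measurable_mk s').comp (A.measurable_newClocks s i s')).comp measurable_prodMk_left
  simp only [h, mul_one]
  rw [← ENNReal.ofReal_sum_of_nonneg fun s' _ => A.next_nonneg s i s', A.next_sum,
    ENNReal.ofReal_one]

theorem measurable_kernelFun : Measurable A.kernelFun := by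
  classical
  refine Measure.measurable_of_measurable_coe _ fun B hB => A.measurable_of_fibers fun s => ?_
  have h_gen : MeasurableSet {c : A.events s → ℝ | A.IsGen ⟨s, c⟩} :=
    A.measurable_mk s A.measurableSet_isGen
  have h : (fun c : A.events s → ℝ => A.kernelFun ⟨s, c⟩ B) = fun c =>
      if A.IsGen ⟨s, c⟩ then ∑ i : A.events s, (if A.IsFirst ⟨s, c⟩ i then A.stepLaw s i c B else 0)
      else Measure.dirac (⟨s, c⟩ : A.Config) B := by
    funext c
    by_cases hc : A.IsGen ⟨s, c⟩
    · simp only [kernelFun, dif_pos hc, if_pos hc]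
      rw [Finset.sum_eq_single (A.firstClock ⟨⟨s, c⟩, hc⟩)]
      · rw [if_pos (A.firstClock_spec ⟨⟨s, c⟩, hc⟩)]
      · intro i _ hi
        exact if_neg fun h => hi (IsFirst.unique A h (A.firstClock_spec ⟨⟨s, c⟩, hc⟩))
      · intro h
        exact absurd (Finset.mem_univ _) h
    · simp only [kernelFun, dif_neg hc, if_neg hc]
  rw [h]
  refine Measurable.ite h_gen (Finset.measurable_sum _ fun i _ => ?_) ?_
  · exact Measurable.ite (A.measurableSet_isFirst s i)
      ((Measure.measurable_coe hB).comp (A.measurable_stepLaw s i)) measurable_const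
  · exact ((Measure.measurable_coe hB).comp Measure.measurable_dirac).comp (A.measurable_mk s)

/-- The transition kernel on configurations. -/
noncomputable def kernel : Kernel A.Config A.Config := ⟨A.kernelFun, A.measurable_kernelFun⟩

instance : IsMarkovKernel A.kernel := ⟨fun x => by
  change IsProbabilityMeasure (A.kernelFun x)
  unfold kernelFun
  split_ifs <;> infer_instance⟩

/-- The law of the discrete-time Markov process started at `x`, on sequences of configurations. -/
noncomputable def seqLaw (x : A.Config) : Measure (ℕ → A.Config) :=
  Kernel.traj (X := fun _ => A.Config)
    (fun n => A.kernel.comap (fun h : (i : Finset.Iic n) → A.Config => h ⟨n, by simp⟩)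
      (measurable_pi_apply _)) 0 fun _ => x

instance (x : A.Config) : IsProbabilityMeasure (A.seqLaw x) := by
  unfold seqLaw
  infer_instance

/-! #### Finitely varying sequences and their traces -/

/-- The time at which the `n`-th configuration of a sequence is entered. -/
noncomputable def entryTime (σ : ℕ → A.Config) (n : ℕ) : ℝ :=
  ∑ j ∈ Finset.range n, A.sojourn (σ j)

/-- The finitely varying (non-Zeno) sequences of generalized states. -/
def finVar : Set (ℕ → A.Config) :=
  {σ | (∀ n, A.IsGen (σ n)) ∧ Tendsto (A.entryTime σ) atTop atTop}

theorem measurableSet_finVar : MeasurableSet A.finVar := by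
  have h1 : MeasurableSet {σ : ℕ → A.Config | ∀ n, A.IsGen (σ n)} := by
    rw [ofPred_forall]
    exact MeasurableSet.iInter fun n =>
      (measurable_pi_apply (X := fun _ : ℕ => A.Config) n) A.measurableSet_isGen
  refine h1.inter (measurableSet_tendsto (f := fun n (σ : ℕ → A.Config) => A.entryTime σ n) _
    fun n => ?_)
  exact Finset.measurable_sum _ fun j _ => A.measurable_sojourn.comp (measurable_pi_apply j)

theorem exists_lt_entryTime (σ : A.finVar) (t : ℝ≥0) : ∃ n, (t : ℝ) < A.entryTime σ.1 (n + 1) :=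
  (((tendsto_add_atTop_iff_nat 1).2 σ.2.2).eventually_gt_atTop (t : ℝ)).exists

open Classical in
/-- The index `n` with `entryTime n ≤ t < entryTime (n + 1)`. -/
noncomputable def index (σ : A.finVar) (t : ℝ≥0) : ℕ := Nat.find (A.exists_lt_entryTime σ t)

theorem lt_entryTime_index (σ : A.finVar) (t : ℝ≥0) :
    (t : ℝ) < A.entryTime σ.1 (A.index σ t + 1) := by
  classical
  exact Nat.find_spec (A.exists_lt_entryTime σ t)

theorem entryTime_index_le (σ : A.finVar) (t : ℝ≥0) : A.entryTime σ.1 (A.index σ t) ≤ t := by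
  classical
  rcases h : A.index σ t with _ | n
  · simp [entryTime]
  · have h1 : n < A.index σ t := by omega
    exact not_lt.1 (Nat.find_min (A.exists_lt_entryTime σ t) h1)

/-- The function `[0,∞) → 𝒢` generated by a finitely varying sequence of generalized states: at time
`t` it is the state entered last, evolved for the time that has passed since it was entered. -/
noncomputable def trace (σ : A.finVar) (t : ℝ≥0) : A.GenState :=
  ⟨A.evolve (σ.1 (A.index σ t)) (t - A.entryTime σ.1 (A.index σ t)),
    A.isGen_evolve (σ.2.1 _) (by
      have h := A.lt_entryTime_index σ t
      rw [entryTime, Finset.sum_range_succ] at h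
      rw [sub_lt_iff_lt_add']
      exact h)⟩

/-- The distribution of the traces that start in `x`: the law of the process, on the finitely varying
sequences of generalized states. -/
noncomputable def traces (x : A.GenState) : Distr A.finVar :=
  ⟨(A.seqLaw x.1).comap Subtype.val, by
    rw [comap_subtype_coe_apply A.measurableSet_finVar]
    exact prob_le_one⟩

/-! #### The functional -/

/-- The functional on pseudometrics: `k * W(J(m))(traces x, traces y)`. -/
noncomputable def functional (k : Set.Ioc (0 : ℝ) 1) (m : UnitPseudoMetric A.GenState) :
    UnitPseudoMetric A.GenState :=
  ((m.J.pullback A.trace).W.pullback A.traces).scale k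

/-- The functional on pseudo-metrizable uniformities: choose a pseudometric that induces `U`, apply
the functional to it, and take the induced uniformity. -/
noncomputable def uniformFunctional (k : Set.Ioc (0 : ℝ) 1) (U : PMU A.GenState) :
    PMU A.GenState :=
  (A.functional k U.2.choose).toPMU

end GSMP

/-! Refinement of induced uniformities is an ε-δ comparison of pseudometrics, so it suffices that
each ingredient of the functional preserves this comparison: the lift `J`, pullback along any map,
the lift `W`, and scaling by `k`. Scaling by a positive constant does not change the uniformity at
all, which is why the discount factor disappears. Nothing about the process is used: `A.trace` and
`A.traces` enter only as maps to pull back along. The step with content is `W`. Suppose `d < δ`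
forces `d' < ε`. A test function `h` for `d'` need not be Lipschitz for `d`, but it varies by less
than `ε` on `d`-balls of radius `δ`. Its least `δ⁻¹`-Lipschitz majorant for `d` then lies between
`h` and `h + ε`, and `δ` times this majorant is a test function for `d`. Hence the integrals of `h`
against `P` and `Q` differ by at most `ε + W(d)(P,Q)/δ` (`lowerIntegral_le_add_wDist`). -/

namespace UnitPseudoMetric

/-! ### Comparison of uniformities; pullback, scaling and the `J₂` lift -/

section Order

variable {M : Type*}

theorem uniformSpace_le_iff (m m' : UnitPseudoMetric M) :
    m.uniformSpace ≤ m'.uniformSpace ↔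
      ∀ ε > 0, ∃ δ > 0, ∀ x y, m.dist x y < δ → m'.dist x y < ε := by
  constructor
  · intro h ε hε
    have h1 : {p : M × M | m'.dist p.1 p.2 < ε} ∈ @uniformity M m.uniformSpace :=
      h ((m'.mem_uniformity_iff _).2 ⟨ε, hε, Subset.rfl⟩)
    obtain ⟨δ, hδ, h2⟩ := (m.mem_uniformity_iff _).1 h1
    exact ⟨δ, hδ, fun x y hxy => @h2 (x, y) hxy⟩
  · intro h E hE
    obtain ⟨ε, hε, h1⟩ := (m'.mem_uniformity_iff E).1 hE
    obtain ⟨δ, hδ, h2⟩ := h ε hε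
    exact (m.mem_uniformity_iff E).2 ⟨δ, hδ, fun p hp => h1 (h2 p.1 p.2 hp)⟩

theorem pullback_uniformSpace_mono {N : Type*} (φ : N → M) {m m' : UnitPseudoMetric M}
    (h : m.uniformSpace ≤ m'.uniformSpace) :
    (m.pullback φ).uniformSpace ≤ (m'.pullback φ).uniformSpace := by
  rw [uniformSpace_le_iff] at h ⊢
  intro ε hε
  obtain ⟨δ, hδ, h1⟩ := h ε hε
  exact ⟨δ, hδ, fun x y => h1 (φ x) (φ y)⟩

theorem scale_uniformSpace (k : Set.Ioc (0 : ℝ) 1) (m : UnitPseudoMetric M) :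
    (m.scale k).uniformSpace = m.uniformSpace := by
  have hk := k.2.1
  refine le_antisymm ((uniformSpace_le_iff _ _).2 fun ε hε => ?_)
    ((uniformSpace_le_iff _ _).2 fun ε hε => ?_)
  · exact ⟨k * ε, mul_pos hk hε, fun x y hxy => lt_of_mul_lt_mul_left hxy hk.le⟩
  · exact ⟨ε, hε, fun x y hxy =>
      (mul_le_of_le_one_left (m.nonneg x y) k.2.2).trans_lt hxy⟩

/-- The time `u` that matches `t` for `m` also matches it for `m'`. In `min δ ε`, the `δ` controls
the distance of the values, while the `ε` controls the time shift, which does not depend on the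
pseudometric. -/
theorem j2Half_le_of_lt {m m' : UnitPseudoMetric M} {ε δ : ℝ}
    (h : ∀ x y, m.dist x y < δ → m'.dist x y < ε) {f g : ℝ≥0 → M}
    (hfg : j2Half m f g < min δ ε) : j2Half m' f g ≤ ε := by
  refine ciSup_le fun t => ?_
  obtain ⟨u, hu⟩ := exists_lt_of_ciInf_lt ((j2_iInf_le_half m f g t).trans_lt hfg)
  rw [max_lt_iff, lt_min_iff, lt_min_iff] at hu
  exact (ciInf_le (j2_bddBelow m' f g t) u).trans (max_le (h _ _ hu.1.1).le hu.2.2.le)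

theorem J_uniformSpace_mono {m m' : UnitPseudoMetric M}
    (h : m.uniformSpace ≤ m'.uniformSpace) : m.J.uniformSpace ≤ m'.J.uniformSpace := by
  rw [uniformSpace_le_iff] at h ⊢
  intro ε hε
  -- Half of `ε`, since a supremum of terms below a bound is only `≤` that bound.
  obtain ⟨δ, hδ, h1⟩ := h (ε / 2) (half_pos hε)
  refine ⟨min δ (ε / 2), lt_min hδ (half_pos hε), fun f g hfg => ?_⟩
  change j2Dist m f g < _ at hfg
  change j2Dist m' f g < ε
  rw [j2Dist_eq] at hfg ⊢
  obtain ⟨h2, h3⟩ := max_lt_iff.1 hfg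
  exact (max_le (j2Half_le_of_lt h1 h2) (j2Half_le_of_lt h1 h3)).trans_lt (half_lt_self hε)

end Order

/-! ### Lipschitz regularization of a bounded function -/

section LipschitzMajorant

variable {Ω : Type*} (d : UnitPseudoMetric Ω)

/-- The least majorant of `h` that is `δ⁻¹`-Lipschitz for `d`. -/
noncomputable def lipMajorant (δ : ℝ) (h : Ω → ℝ) (x : Ω) : ℝ :=
  ⨆ y, (h y - d.dist x y / δ)

variable {d} {δ : ℝ} {h : Ω → ℝ}

/-- The bound `h ≤ 1` makes the family bounded above, so that the real supremum is a genuine one and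
not the default value. -/
theorem sub_div_le_lipMajorant (hδ : 0 < δ) (h_one : ∀ x, h x ≤ 1) (x y : Ω) :
    h y - d.dist x y / δ ≤ d.lipMajorant δ h x := by
  refine le_ciSup (f := fun y => h y - d.dist x y / δ) ⟨1, ?_⟩ y
  rintro _ ⟨z, rfl⟩
  have := div_nonneg (d.nonneg x z) hδ.le
  linarith [h_one z]

theorem le_lipMajorant (hδ : 0 < δ) (h_one : ∀ x, h x ≤ 1) (x : Ω) :
    h x ≤ d.lipMajorant δ h x := by
  simpa [d.self] using sub_div_le_lipMajorant (d := d) hδ h_one x x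

theorem lipMajorant_le {x : Ω} {b : ℝ} (hb : ∀ y, h y - d.dist x y / δ ≤ b) :
    d.lipMajorant δ h x ≤ b :=
  have : Nonempty Ω := ⟨x⟩
  ciSup_le hb

theorem lipMajorant_le_add (hδ : 0 < δ) (h_one : ∀ x, h x ≤ 1) (x y : Ω) :
    d.lipMajorant δ h x ≤ d.lipMajorant δ h y + d.dist x y / δ := by
  refine lipMajorant_le fun z => ?_
  have h1 := sub_div_le_lipMajorant (d := d) hδ h_one y z
  have h2 : d.dist y z / δ ≤ d.dist x y / δ + d.dist x z / δ := by
    rw [← add_div, d.symm x y]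
    exact div_le_div_of_nonneg_right (d.triangle y x z) hδ.le
  linarith

/-- `δ` times the Lipschitz majorant, as a test function for the Wasserstein metric of `d`. -/
noncomputable def scaledLipMajorant (d : UnitPseudoMetric Ω) {δ : ℝ} (hδ : 0 < δ) (hδ_one : δ ≤ 1)
    {h : Ω → ℝ} (h_nonneg : ∀ x, 0 ≤ h x) (h_one : ∀ x, h x ≤ 1) : d.Lip :=
  ⟨fun x => δ * d.lipMajorant δ h x, fun x =>
    ⟨mul_nonneg hδ.le ((h_nonneg x).trans (le_lipMajorant hδ h_one x)),
      mul_le_one₀ hδ_one ((h_nonneg x).trans (le_lipMajorant hδ h_one x))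
        (lipMajorant_le fun y => by
          have := div_nonneg (d.nonneg x y) hδ.le
          linarith [h_one y])⟩,
    fun x y => by
      -- The factor `δ` turns the Lipschitz constant `δ⁻¹` into `1`.
      rw [← mul_sub, abs_mul, abs_of_pos hδ, ← le_div_iff₀' hδ, abs_sub_le_iff]
      have h1 := lipMajorant_le_add (d := d) hδ h_one x y
      have h2 := lipMajorant_le_add (d := d) hδ h_one y x
      rw [d.symm y x] at h2
      constructor <;> linarith⟩

end LipschitzMajorant

/-! ### Lower integrals and the Wasserstein lift -/

section Wasserstein

variable {Ω : Type*} [MeasurableSpace Ω]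

theorem lintegral_ofReal_ne_top (P : Distr Ω) {h : Ω → ℝ} {b : ℝ} (h_le : ∀ x, h x ≤ b) :
    ∫⁻ x, ENNReal.ofReal (h x) ∂P.1 ≠ ∞ := by
  have : IsFiniteMeasure P.1 := ⟨P.2.trans_lt ENNReal.one_lt_top⟩
  refine ((lintegral_mono fun x => ENNReal.ofReal_le_ofReal (h_le x)).trans_lt ?_).ne
  rw [lintegral_const]
  exact ENNReal.mul_lt_top ENNReal.ofReal_lt_top (measure_lt_top _ _)

theorem lowerIntegral_mono (P : Distr Ω) {h h' : Ω → ℝ} {b : ℝ} (hh : ∀ x, h x ≤ h' x)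
    (h_le : ∀ x, h' x ≤ b) : lowerIntegral P.1 h ≤ lowerIntegral P.1 h' :=
  ENNReal.toReal_mono (lintegral_ofReal_ne_top P h_le)
    (lintegral_mono fun x => ENNReal.ofReal_le_ofReal (hh x))

theorem lowerIntegral_const_mul (P : Distr Ω) {c : ℝ} (hc : 0 ≤ c) (h : Ω → ℝ) :
    lowerIntegral P.1 (fun x => c * h x) = c * lowerIntegral P.1 h := by
  simp only [lowerIntegral, ENNReal.ofReal_mul hc]
  rw [lintegral_const_mul' _ _ ENNReal.ofReal_ne_top, ENNReal.toReal_mul, ENNReal.toReal_ofReal hc]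

/-- Lower integrals are not additive in general, but they are when one summand is measurable, here
the constant; its integral is at most `ε` because the mass is at most one. -/
theorem lowerIntegral_add_const_le (P : Distr Ω) {h : Ω → ℝ} {b ε : ℝ} (hε : 0 ≤ ε)
    (h_nonneg : ∀ x, 0 ≤ h x) (h_le : ∀ x, h x ≤ b) :
    lowerIntegral P.1 (fun x => h x + ε) ≤ lowerIntegral P.1 h + ε := by
  have h1 : ∫⁻ x, ENNReal.ofReal (h x + ε) ∂P.1 ≤
      ∫⁻ x, ENNReal.ofReal (h x) ∂P.1 + ENNReal.ofReal ε := by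
    simp only [fun x => ENNReal.ofReal_add (h_nonneg x) hε]
    rw [lintegral_add_right _ measurable_const, lintegral_const]
    gcongr
    exact mul_le_of_le_one_right' P.2
  have h2 := lintegral_ofReal_ne_top P h_le
  refine (ENNReal.toReal_mono (ENNReal.add_ne_top.2 ⟨h2, ENNReal.ofReal_ne_top⟩) h1).trans ?_
  rw [ENNReal.toReal_add h2 ENNReal.ofReal_ne_top, ENNReal.toReal_ofReal hε]
  rfl

/-- Pass from `h` up to its majorant under `P`, change `P` to `Q` at cost `wDist d P Q / δ`, and
come back down to `h` under `Q` at cost `ε`. Only monotonicity, homogeneity and addition of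
constants are needed, so `h` may be non-measurable. -/
theorem lowerIntegral_le_add_wDist {d d' : UnitPseudoMetric Ω} {ε δ : ℝ} (hε : 0 ≤ ε)
    (hδ : 0 < δ) (hδ_one : δ ≤ 1) (hd : ∀ x y, d.dist x y < δ → d'.dist x y < ε)
    (P Q : Distr Ω) (h : d'.Lip) :
    lowerIntegral P.1 h.1 ≤ lowerIntegral Q.1 h.1 + ε + wDist d P Q / δ := by
  have h_nonneg := fun x => (h.2.1 x).1
  have h_one := fun x => (h.2.1 x).2
  have h_upper : ∀ x, d.lipMajorant δ h.1 x ≤ h.1 x + ε := fun x => lipMajorant_le fun y => by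
    -- A near `y` has `h y < h x + ε`; for a far `y` the penalty `d.dist x y / δ` is at least `1`
    -- and absorbs `h y ≤ 1`.
    rcases lt_or_ge (d.dist x y) δ with hxy | hxy
    · have h1 := (abs_le.1 (h.2.2 x y)).1
      have h2 := div_nonneg (d.nonneg x y) hδ.le
      linarith [hd x y hxy]
    · have h1 := (one_le_div hδ).2 hxy
      linarith [h_one y, h_nonneg x]
  have h_upper' : ∀ x, d.lipMajorant δ h.1 x ≤ 1 + ε := fun x => by
    linarith [h_upper x, h_one x]
  have h1 : lowerIntegral P.1 h.1 ≤ lowerIntegral P.1 (d.lipMajorant δ h.1) :=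
    lowerIntegral_mono P (le_lipMajorant hδ h_one) h_upper'
  have h2 : lowerIntegral Q.1 (d.lipMajorant δ h.1) ≤ lowerIntegral Q.1 h.1 + ε :=
    (lowerIntegral_mono Q (b := 1 + ε) h_upper fun x => by linarith [h_one x]).trans
      (lowerIntegral_add_const_le Q hε h_nonneg h_one)
  have h3 := (le_abs_self _).trans
    (le_wDist d P Q (d.scaledLipMajorant hδ hδ_one h_nonneg h_one))
  simp only [scaledLipMajorant] at h3
  rw [lowerIntegral_const_mul P hδ.le, lowerIntegral_const_mul Q hδ.le, ← mul_sub,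
    ← le_div_iff₀' hδ] at h3
  linarith

theorem W_uniformSpace_mono {d d' : UnitPseudoMetric Ω} (h : d.uniformSpace ≤ d'.uniformSpace) :
    d.W.uniformSpace ≤ d'.W.uniformSpace := by
  rw [uniformSpace_le_iff] at h ⊢
  intro ε hε
  obtain ⟨δ₀, hδ₀, h₀⟩ := h (ε / 3) (by positivity)
  -- With `δ ≤ 1` the scaled majorant still takes values in `[0,1]`.
  set δ := min δ₀ 1
  have hδ : 0 < δ := lt_min hδ₀ one_pos
  have hd : ∀ x y, d.dist x y < δ → d'.dist x y < ε / 3 := fun x y hxy =>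
    h₀ x y (hxy.trans_le (min_le_left _ _))
  -- One third of `ε` pays for the majorant and one for `wDist d P Q / δ`; the last keeps the
  -- inequality strict after the supremum.
  refine ⟨δ * (ε / 3), by positivity, fun P Q hPQ => ?_⟩
  have h_div : wDist d P Q / δ < ε / 3 := (div_lt_iff₀' hδ).2 hPQ
  have h_symm : wDist d Q P = wDist d P Q := d.W.symm Q P
  have h_le : wDist d' P Q ≤ 2 * (ε / 3) := ciSup_le fun f => by
    have h1 := lowerIntegral_le_add_wDist (by positivity) hδ (min_le_right _ _) hd P Q f
    have h2 := lowerIntegral_le_add_wDist (by positivity) hδ (min_le_right _ _) hd Q P f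
    rw [h_symm] at h2
    exact abs_sub_le_iff.2 ⟨by linarith, by linarith⟩
  change wDist d' P Q < ε
  linarith

end Wasserstein

end UnitPseudoMetric

/-! ### The functional on uniformities -/

namespace GSMP

variable {AP S E : Type*} [Fintype S] (A : GSMP AP S E)

/-- Allowing two discount factors lets this one comparison, used in both directions, give both
well-definedness and independence of `k`. -/
theorem functional_uniformSpace_mono (k k' : Set.Ioc (0 : ℝ) 1)
    {m m' : UnitPseudoMetric A.GenState} (h : m.uniformSpace ≤ m'.uniformSpace) :
    (A.functional k m).uniformSpace ≤ (A.functional k' m').uniformSpace := by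
  unfold functional
  rw [UnitPseudoMetric.scale_uniformSpace, UnitPseudoMetric.scale_uniformSpace]
  exact UnitPseudoMetric.pullback_uniformSpace_mono _ (UnitPseudoMetric.W_uniformSpace_mono
    (UnitPseudoMetric.pullback_uniformSpace_mono _ (UnitPseudoMetric.J_uniformSpace_mono h)))

theorem functional_toPMU_congr (k k' : Set.Ioc (0 : ℝ) 1) {m m' : UnitPseudoMetric A.GenState}
    (h : m.uniformSpace = m'.uniformSpace) :
    (A.functional k m).toPMU = (A.functional k' m').toPMU :=
  Subtype.ext (le_antisymm (A.functional_uniformSpace_mono k k' h.le)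
    (A.functional_uniformSpace_mono k' k h.ge))

end GSMP

/-- For every discount factor the functional on pseudo-metrizable uniformities is well defined (its
value at the uniformity induced by `m` is the uniformity induced by the value at `m`, whichever `m`
is taken), and it does not depend on the discount factor. -/
theorem mainTheorem6 {AP S E : Type*} [Fintype S] (A : GSMP AP S E) :
    (∀ (k : Set.Ioc (0 : ℝ) 1) (m : UnitPseudoMetric A.GenState),
      A.uniformFunctional k m.toPMU = (A.functional k m).toPMU) ∧
    ∀ k k' : Set.Ioc (0 : ℝ) 1, A.uniformFunctional k = A.uniformFunctional k' :=
  -- The chosen pseudometric may differ from `m`, but it induces the same uniformity. In the second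
  -- part the choice depends only on the uniformity, so both factors meet the same pseudometric.
  ⟨fun k m => A.functional_toPMU_congr k k m.toPMU.2.choose_spec,
    fun k k' => funext fun _ => A.functional_toPMU_congr k k' rfl⟩
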